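/- Let $p$ be a prime, $\zeta_p=e^{2\pi\sqrt{-1}/p}$, and let $V_n$, $V_m$ be vector spaces over $\mathbb F_p$ of dimensions $n$ and $m$, each with a non-degenerate symmetric bilinear form $\langle\cdot,\cdot\rangle$ (an inner product). Write $A^*=A\setminus\{0\}$ for a subset $A$ of $V_n$ or $V_m$. For $f:V_n\to\mathbb F_p$ put $W_f(a)=\sum_{x\in V_n}\zeta_p^{f(x)-\langle a,x\rangle}$, $a\in V_n$; $f$ is bent if $|W_f(a)|=p^{n/2}$ for all $a$. The dual of a bent function $f$ is the function $f^*:V_n\to\mathbb F_p$ such that, for all $a$, $W_f(a)=\epsilon_a\,p^{n/2}\zeta_p^{f^*(a)}$, where $\epsilon_a=1$ if $p=2$; $\epsilon_a\in\{\pm1\}$ if $p$ is odd and $p\equiv1\pmod 4$ or $n$ is even; and $\epsilon_a\in\{\pm\sqrt{-1}\}$ if $p\equiv3\pmod 4$ and $n$ is odd. Put $\varepsilon_f(x)=p^{-n/2}\zeta_p^{-f^*(x)}W_f(x)$. For $F:V_n\to V_m$ and $c\in V_m$ let $F_c(x)=\langle c,F(x)\rangle$. $F$ is vectorial bent if $F_c$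 is bent for all $c\in V_m^*$. It is vectorial dual-bent if it is vectorial bent and the functions $(F_c)^*$, $c\in V_m^*$, together with the zero function, form an $m$-dimensional vector space all of whose nonzero elements are bent. A vectorial dual of $F$ is a vectorial bent function $F^*:V_n\to V_m$ such that $(F_c)^*=(F^*)_{\sigma(c)}$ for all $c\in V_m^*$, for some permutation $\sigma$ of $V_m^*$. A $d$-class association scheme on a nonempty finite set $X$ consists of nonempty relations $R_0,\dots,R_d\subseteq X\times X$ that partition $X\times X$, such that $R_0=\{(x,x):x\in X\}$, the transpose of each $R_i$ is some $R_j$, and for all $i,j,k$ and $(x,y)\in R_k$ the number $|\{z\in X:(x,z)\in R_i,(z,y)\in R_j\}|$ depends only on $i,j,k$. Let $F:V_n\to V_m$ be vectorial dual-bent with $F(0)=0$, $F(x)=F(-x)$ for all $x$, and $2\le m\le n/2$, and let $F^*$ be a vectorial dual of $F$. Put $I=F(V_n^*)$, $D_{F,i}=\{x\in V_n:F(x)=i\}$, $R_{id}=\{(x,x):x\in V_n\}$ and $R_i=\{(x,y)\in V_n\times V_n:x-y\in D_{F,i}^*\}$ for $i\in I$. Then: (a) If $n$ is even, $m=n/2$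 and $\varepsilon_{F_c}(0)=-1$ for all $c\in V_m^*$, then $I=V_m^*$ and $|I|=p^m-1$. In all other cases $I=V_m$ and $|I|=p^m$. (b) $\{R_{id},R_i,\,i\in I\}$ is an $|I|$-class association scheme on $V_n$ if and only if for all $\beta,\beta'\in V_n^*$ with $F^*(\beta)=F^*(\beta')$ one has $\varepsilon_{F_c}(\beta)=\varepsilon_{F_c}(\beta')$ for all $c\in V_m^*$. -/

import Mathlib

noncomputable section

namespace DualBent

variable {p : ℕ} [Fact p.Prime]
variable {V : Type*} [AddCommGroup V] [Module (ZMod p) V] [Fintype V]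
variable {W : Type*} [AddCommGroup W] [Module (ZMod p) W]

/-- A (non-degenerate) inner product on a vector space over the prime field: a symmetric
non-degenerate bilinear form. -/
def IsInnerProduct (B : LinearMap.BilinForm (ZMod p) W) : Prop :=
  B.IsSymm ∧ B.Nondegenerate

/-- The Walsh transform `W_f(a) = ∑ x, ζ_p ^ (f x - ⟨a, x⟩)`. The standard additive character
of `ZMod p` is `j ↦ exp (2 π i j / p) = ζ_p ^ j`. -/
def walsh (B : LinearMap.BilinForm (ZMod p) V) (f : V → ZMod p) (a : V) : ℂ :=
  ∑ x : V, ZMod.stdAddChar (f x - B a x)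

variable (p V) in
/-- The number `p ^ (n / 2) = (√p) ^ n`, where `n` is the dimension of `V`. -/
def halfPow : ℝ := √(p : ℝ) ^ Module.finrank (ZMod p) V

/-- `f` is bent: `|W_f(a)| = p ^ (n / 2)` for all `a`. -/
def IsBent (B : LinearMap.BilinForm (ZMod p) V) (f : V → ZMod p) : Prop :=
  ∀ a : V, ‖walsh B f a‖ = halfPow p V

/-- The values which the factor `ε` in `W_f(a) = ε p ^ (n / 2) ζ_p ^ (f* a)` may take:
`1` if `p = 2`; `± 1` if `p` is odd and `p ≡ 1 (mod 4)` or `n` is even; `± √-1` if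
`p ≡ 3 (mod 4)` and `n` is odd. -/
def IsAdmissibleFactor (p n : ℕ) (ε : ℂ) : Prop :=
  if p = 2 then ε = 1
  else if p % 4 = 1 ∨ Even n then ε = 1 ∨ ε = -1
  else ε = Complex.I ∨ ε = -Complex.I

/-- `g` is the dual of `f`: for each `a`, `W_f(a) = ε p ^ (n / 2) ζ_p ^ (g a)` with an
admissible factor `ε` (which may depend on `a`). -/
def IsDual (B : LinearMap.BilinForm (ZMod p) V) (f g : V → ZMod p) : Prop :=
  ∀ a : V, ∃ ε : ℂ, IsAdmissibleFactor p (Module.finrank (ZMod p) V) ε ∧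
    walsh B f a = ε * (halfPow p V : ℂ) * ZMod.stdAddChar (g a)

open Classical in
/-- The dual `f*` of a bent function `f` (and `0` for a function `f` that has no dual). -/
def dual (B : LinearMap.BilinForm (ZMod p) V) (f : V → ZMod p) : V → ZMod p :=
  if h : ∃ g, IsDual B f g then h.choose else 0

/-- `ε_f(x) = p ^ (- n / 2) ζ_p ^ (- f* x) W_f(x)`. -/
def eps (B : LinearMap.BilinForm (ZMod p) V) (f : V → ZMod p) (x : V) : ℂ :=
  (halfPow p V : ℂ)⁻¹ * ZMod.stdAddChar (-dual B f x) * walsh B f x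

/-- The component function `F_c(x) = ⟨c, F x⟩`. -/
def component (B : LinearMap.BilinForm (ZMod p) W) (F : V → W) (c : W) : V → ZMod p :=
  fun x => B c (F x)

/-- `F` is vectorial bent: all components `F_c`, `c ≠ 0`, are bent. -/
def IsVectorialBent (BV : LinearMap.BilinForm (ZMod p) V) (BW : LinearMap.BilinForm (ZMod p) W)
    (F : V → W) : Prop :=
  ∀ c : W, c ≠ 0 → IsBent BV (component BW F c)

/-- `F` is vectorial dual-bent: `F` is vectorial bent, and the duals of the components `F_c`,
`c ≠ 0`, together with the zero function, form a vector space of bent functions (that is, all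
its nonzero elements are bent) whose dimension is the dimension of the codomain of `F`. -/
def IsVectorialDualBent (BV : LinearMap.BilinForm (ZMod p) V)
    (BW : LinearMap.BilinForm (ZMod p) W) (F : V → W) : Prop :=
  IsVectorialBent BV BW F ∧
    ∃ S : Submodule (ZMod p) (V → ZMod p),
      (S : Set (V → ZMod p)) = {g | ∃ c : W, c ≠ 0 ∧ g = dual BV (component BW F c)} ∪ {0} ∧
      Module.finrank (ZMod p) S = Module.finrank (ZMod p) W ∧
      ∀ g ∈ S, g ≠ 0 → IsBent BV g

/-- `G` is a vectorial dual of `F`: `G` is vectorial bent and `(F_c)* = G_{σ(c)}`, `c ≠ 0`, for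
some permutation `σ` of the nonzero vectors. -/
def IsVectorialDual (BV : LinearMap.BilinForm (ZMod p) V)
    (BW : LinearMap.BilinForm (ZMod p) W) (F G : V → W) : Prop :=
  IsVectorialBent BV BW G ∧
    ∃ σ : Equiv.Perm {c : W // c ≠ 0}, ∀ c : {c : W // c ≠ 0},
      dual BV (component BW F c) = component BW G (σ c)

/-- A `d`-class association scheme on a nonempty finite set `X`. The relations are
`R none` (the relation `R_0`) and `R (some i)`, with `i` in an index set of `d` elements. -/
structure IsAssociationScheme {X ι : Type*} (d : ℕ) (R : Option ι → Set (X × X)) : Prop where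
  finite_index : Finite ι
  card_index : Nat.card ι = d
  finite : Finite X
  nonempty : Nonempty X
  nonempty_rel : ∀ i, (R i).Nonempty
  diagonal : R none = {q | q.1 = q.2}
  union : ⋃ i, R i = Set.univ
  disjoint : ∀ i j, i ≠ j → R i ∩ R j = ∅
  transpose : ∀ i, ∃ j, {q : X × X | (q.2, q.1) ∈ R i} = R j
  intersection : ∀ k i j, ∀ q ∈ R k, ∀ q' ∈ R k,
    {z : X | (q.1, z) ∈ R i ∧ (z, q.2) ∈ R j}.ncard =
      {z : X | (q'.1, z) ∈ R i ∧ (z, q'.2) ∈ R j}.ncard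

/-- The image `I = F(V \ {0})`. -/
def punctImage {V W : Type*} [Zero V] (F : V → W) : Set W := F '' {x | x ≠ 0}

/-- The relations `R_id = {(x, x)}` and `R_i = {(x, y) : x - y ∈ D_{F,i} \ {0}}`, `i ∈ I`,
where `D_{F,i} = {x : F x = i}` and `I = F(V \ {0})`. -/
def translationRel {V W : Type*} [AddCommGroup V] (F : V → W) :
    Option (punctImage F) → Set (V × V)
  | none => {q | q.1 = q.2}
  | some i => {q | q.1 - q.2 ∈ {x : V | F x = i} \ {0}}

end DualBent

end

/-!
The fibres `D_i` of `F` and the Walsh values of its components are related by Fourier inversion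
over the components (`sum_walsh_component`). Write `q = p ^ (n / 2)`, `M = p ^ m`, `G` for the
vectorial dual, and `W_{F_c}(b) = ε_c(b) q ζ ^ ⟨σ c, G b⟩`.

**Images.** Counting a fibre of a vectorial bent function `H` by the values `W_{H_c}(0)` shows that
no fibre is empty, and that a fibre can be a single point only if `q = M` and every nontrivial term
is `-M` (`IsVectorialBent.of_card_fiber_eq_one`). For `F` at `0` this is the exceptional case.
Conversely, in the exceptional case the count of zeros of `F` is `1` or `M + 1`, and it is odd
because `F` is even (`fiber_zero_of_eps_zero`).

The image of `G` on nonzero vectors has the same size as that of `F`. In the exceptional case, an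
even number of signs `ε_c(b)` cannot add up to `1`, so `G b ≠ 0` for `b ≠ 0`
(`dual_ne_zero_of_eps_zero`). If the fibre of `G` over `G 0` is a point, then so is the fibre of `F`
over `0` (`fiber_zero_of_dual_fiber_zero`): for odd `p` the factors are signs, so that
`W_{G_{σ c}}(x)` and `M ζ ^ (F_c x)` are congruent modulo `2` in the algebraic integers, and these
congruences conflict with the counting formula for `G` at another zero of `F`.

**The scheme.** The intersection numbers exist if and only if the functions constant on the classes
are closed under convolution (`isAssociationScheme_iff_conv`). The Fourier transforms of these
functions form a space of dimension `|I| + 1`, and they separate the fibres of `G` on the nonzero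
vectors, of which there are `|I|`. A unital algebra of functions on a finite set consists of all
functions on the classes that it does not separate (`mem_subalgebra_of_separates`); comparing
dimensions, closure under convolution holds if and only if the transforms are constant on the
fibres of `G` (`conv_mem_iff_fourier_const`), which says that the factors depend on `G b` only.
-/

open Finset

noncomputable section

namespace DualBent

/-! ### Character sums and the Fourier transform -/

section Fourier

variable {p : ℕ} [Fact p.Prime]
variable {V : Type*} [AddCommGroup V] [Module (ZMod p) V] [Fintype V]

/-- The Fourier transform `b ↦ ∑ x, f x ζ_p ^ (-⟨b, x⟩)`, with the characters of `V` indexed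
by `V` itself through the inner product. -/
def fourier (B : LinearMap.BilinForm (ZMod p) V) : (V → ℂ) →ₗ[ℂ] (V → ℂ) where
  toFun f b := ∑ x, f x * ZMod.stdAddChar (-(B b x))
  map_add' f g := by
    ext b
    simp [add_mul, sum_add_distrib]
  map_smul' r f := by
    ext b
    simp [mul_assoc, mul_sum]

theorem fourier_apply (B : LinearMap.BilinForm (ZMod p) V) (f : V → ℂ) (b : V) :
    fourier B f b = ∑ x, f x * ZMod.stdAddChar (-(B b x)) := rfl

theorem walsh_eq_fourier (B : LinearMap.BilinForm (ZMod p) V) (f : V → ZMod p) (b : V) :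
    walsh B f b = fourier B (fun x => ZMod.stdAddChar (f x)) b := by
  simp only [walsh, fourier_apply, sub_eq_add_neg, AddChar.map_add_eq_mul]

open Classical in
theorem sum_stdAddChar {B : LinearMap.BilinForm (ZMod p) V} (hB : IsInnerProduct B) (a : V) :
    ∑ x, (ZMod.stdAddChar (B a x) : ℂ) = if a = 0 then (Fintype.card V : ℂ) else 0 := by
  have h := AddChar.sum_eq_ite
    ((ZMod.stdAddChar (N := p)).compAddMonoidHom (B a).toAddMonoidHom)
  simp only [AddChar.compAddMonoidHom_apply, LinearMap.toAddMonoidHom_coe] at h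
  rw [h]
  congr 1
  apply propext
  constructor
  · intro h0
    refine hB.2.1 a fun y => ?_
    have h1 := DFunLike.congr_fun h0 y
    simp only [AddChar.compAddMonoidHom_apply, LinearMap.toAddMonoidHom_coe,
      AddChar.zero_apply] at h1
    exact ZMod.injective_stdAddChar (h1.trans (AddChar.map_zero_eq_one _).symm)
  · rintro rfl
    ext y
    simp

theorem fourier_inversion {B : LinearMap.BilinForm (ZMod p) V} (hB : IsInnerProduct B)
    (f : V → ℂ) (x : V) :
    ∑ b, fourier B f b * ZMod.stdAddChar (B b x) = Fintype.card V * f x := by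
  classical
  simp only [fourier_apply, sum_mul]
  rw [sum_comm]
  have h : ∀ y, ∑ b, f y * ZMod.stdAddChar (-(B b y)) * ZMod.stdAddChar (B b x) =
      f y * if x - y = 0 then (Fintype.card V : ℂ) else 0 := by
    intro y
    rw [← sum_stdAddChar hB, mul_sum]
    refine sum_congr rfl fun b _ => ?_
    rw [mul_assoc, ← AddChar.map_add_eq_mul, hB.1.eq (x - y) b, map_sub]
    congr 2
    ring
  simp only [h, sub_eq_zero]
  simp [mul_comm]

theorem fourier_injective {B : LinearMap.BilinForm (ZMod p) V} (hB : IsInnerProduct B) :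
    Function.Injective (fourier B) := by
  intro f g h
  ext x
  have h1 := fourier_inversion hB f x
  rw [h, fourier_inversion hB g x] at h1
  exact (mul_left_cancel₀ (Nat.cast_ne_zero.2 Fintype.card_ne_zero) h1).symm

/-- Convolution of functions on `V`. -/
def conv (f g : V → ℂ) : V → ℂ := fun x => ∑ z, f (x - z) * g z

theorem fourier_conv (B : LinearMap.BilinForm (ZMod p) V) (f g : V → ℂ) :
    fourier B (conv f g) = fourier B f * fourier B g := by
  ext b
  simp only [fourier_apply, conv, Pi.mul_apply, sum_mul]
  rw [sum_comm]
  simp only [mul_sum]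
  rw [sum_comm (s := univ) (t := univ) (f := fun x y => f x * _ * _)]
  refine sum_congr rfl fun z _ => ?_
  symm
  rw [← (Equiv.subRight z).sum_comp]
  refine sum_congr rfl fun x _ => ?_
  have hx : ZMod.stdAddChar (-(B b x)) =
      (ZMod.stdAddChar (-(B b (x - z))) * ZMod.stdAddChar (-(B b z)) : ℂ) := by
    rw [← AddChar.map_add_eq_mul, map_sub]
    congr 1
    ring
  rw [hx]
  simp only [Equiv.subRight_apply]
  ring

open Classical in
theorem fourier_one {B : LinearMap.BilinForm (ZMod p) V} (hB : IsInnerProduct B) (b : V) :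
    fourier B 1 b = if b = 0 then (Fintype.card V : ℂ) else 0 := by
  have h := sum_stdAddChar hB (-b)
  simp only [map_neg, LinearMap.neg_apply, neg_eq_zero] at h
  simpa [fourier_apply] using h

open Classical in
theorem fourier_single_zero (B : LinearMap.BilinForm (ZMod p) V) :
    fourier B (fun x => if x = 0 then 1 else 0) = 1 := by
  ext b
  simp [fourier_apply]

end Fourier

/-! ### Functions that factor through a map -/

section Factor

/-- The functions that are constant on the fibres of `q`. -/
def fiberConst {X K : Type*} (q : X → K) : Submodule ℂ (X → ℂ) where
  carrier := {f | ∀ x y, q x = q y → f x = f y}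
  add_mem' hf hg x y h := by simp [hf x y h, hg x y h]
  zero_mem' _ _ _ := rfl
  smul_mem' r f hf x y h := by simp [hf x y h]

theorem mem_fiberConst {X K : Type*} {q : X → K} {f : X → ℂ} :
    f ∈ fiberConst q ↔ ∀ x y, q x = q y → f x = f y := Iff.rfl

theorem finrank_fiberConst {X K : Type*} [Finite X] (q : X → K) :
    Module.finrank ℂ (fiberConst q) = (Set.range q).ncard := by
  classical
  have := Fintype.ofFinite (Set.range q)
  have hsurj := Set.rangeFactorization_surjective (f := q)
  have hrange : fiberConst q = (LinearMap.funLeft ℂ ℂ (Set.rangeFactorization q)).range := by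
    ext f
    simp only [mem_fiberConst, LinearMap.mem_range]
    constructor
    · intro hf
      refine ⟨fun k => f (hsurj k).choose, funext fun x => ?_⟩
      exact hf _ _ (congrArg Subtype.val (hsurj (Set.rangeFactorization q x)).choose_spec)
    · rintro ⟨g, rfl⟩ x y h
      exact congrArg g (Subtype.ext h)
  rw [hrange, LinearMap.finrank_range_of_inj
      (LinearMap.funLeft_injective_of_surjective _ _ _ hsurj),
    Module.finrank_fintype_fun_eq_card, ← Nat.card_eq_fintype_card, Nat.card_coe_set_eq]

/-- A finite Stone–Weierstrass theorem: a unital algebra of functions on a finite set contains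
every function that is constant on the classes that the algebra does not separate. -/
theorem mem_subalgebra_of_separates {X : Type*} [Finite X] (A : Subalgebra ℂ (X → ℂ)) (g : X → ℂ)
    (hg : ∀ x y, (∀ f ∈ A, f x = f y) → g x = g y) : g ∈ A := by
  classical
  have := Fintype.ofFinite X
  -- The indicator of the class of `a`, as a product of affine functions of elements of `A`.
  have hind : ∀ a, ∃ e ∈ A, ∀ y, e y = if ∀ f ∈ A, f a = f y then 1 else 0 := by
    intro a
    have hsep : ∀ y, ∃ e ∈ A, (∀ z, (∀ f ∈ A, f a = f z) → e z = 1) ∧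
        (¬ (∀ f ∈ A, f a = f y) → e y = 0) := by
      intro y
      by_cases hy : ∀ f ∈ A, f a = f y
      · exact ⟨1, A.one_mem, fun _ _ => rfl, fun h => absurd hy h⟩
      · push Not at hy
        obtain ⟨f, hf, hne⟩ := hy
        have hne' : f a - f y ≠ 0 := sub_ne_zero.2 hne
        refine ⟨(f a - f y)⁻¹ • (f - algebraMap ℂ _ (f y)),
          A.smul_mem (A.sub_mem hf (A.algebraMap_mem _)) _, fun z hz => ?_, fun _ => ?_⟩
        · simp [← hz f hf, inv_mul_cancel₀ hne']
        · simp
    choose e heA he1 he0 using hsep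
    refine ⟨∏ y, e y, A.prod_mem fun y _ => heA y, fun z => ?_⟩
    rw [Finset.prod_apply]
    split_ifs with hz
    · exact prod_eq_one fun y _ => he1 y z hz
    · exact prod_eq_zero (mem_univ z) (he0 z hz)
  choose e heA he using hind
  -- Each class is hit once for each of its elements, hence the division by its size.
  have hrep : g = ∑ a, (g a / #{y | ∀ f ∈ A, f a = f y}) • e a := by
    ext x
    simp only [Finset.sum_apply, Pi.smul_apply, smul_eq_mul, he, mul_ite, mul_one, mul_zero]
    rw [← sum_filter]
    have hterm : ∀ a ∈ univ.filter (fun a => ∀ f ∈ A, f a = f x),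
        g a / #{y | ∀ f ∈ A, f a = f y} = g x / #{y | ∀ f ∈ A, f y = f x} := by
      intro a ha
      have ha' := (mem_filter.1 ha).2
      rw [hg a x ha']
      congr 3
      ext y
      simp only [mem_filter_univ]
      exact forall₂_congr fun f hf => by rw [ha' f hf, eq_comm]
    rw [sum_congr rfl hterm, sum_const, nsmul_eq_mul, mul_div_cancel₀]
    exact Nat.cast_ne_zero.2 (card_ne_zero.2 ⟨x, by simp⟩)
  rw [hrep]
  exact A.sum_mem fun a _ => A.smul_mem (heA a) _

end Factor

/-! ### The dual partition criterion -/

section Criterion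

variable {p : ℕ} [Fact p.Prime]
variable {V : Type*} [AddCommGroup V] [Module (ZMod p) V] [Fintype V]

/-- Let `τ` have as many nonempty fibres as `π`, and let the Fourier transforms of the functions
constant on the fibres of `π` separate the fibres of `τ`. Then these functions are closed under
convolution if and only if their transforms are constant on the fibres of `τ`. The reason is that
the transforms form an algebra of dimension the number of fibres of `π`, and an algebra of
functions is the space of all functions on the classes that it does not separate. -/
theorem conv_mem_iff_fourier_const {B : LinearMap.BilinForm (ZMod p) V} (hB : IsInnerProduct B)
    {K L : Type*} (π : V → K) (τ : V → L) (hcard : (Set.range π).ncard = (Set.range τ).ncard)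
    (hπ0 : ∀ x, π x = π 0 → x = 0)
    (hsep : ∀ b b', (∀ f ∈ fiberConst π, fourier B f b = fourier B f b') → τ b = τ b') :
    (∀ f ∈ fiberConst π, ∀ g ∈ fiberConst π, conv f g ∈ fiberConst π) ↔
      ∀ b b', τ b = τ b' → ∀ f ∈ fiberConst π, fourier B f b = fourier B f b' := by
  classical
  have hrank : Module.finrank ℂ ((fiberConst π).map (fourier B)) =
      Module.finrank ℂ (fiberConst τ) := by
    rw [(Submodule.equivMapOfInjective _ (fourier_injective hB) _).finrank_eq.symm,
      finrank_fiberConst, finrank_fiberConst, hcard]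
  constructor
  · intro hconv
    let A : Subalgebra ℂ (V → ℂ) :=
      ((fiberConst π).map (fourier B)).toSubalgebra
        ⟨fun x => if x = 0 then 1 else 0, by
          intro x y hxy
          have : x = 0 ↔ y = 0 := by
            constructor
            · rintro rfl
              exact hπ0 y hxy.symm
            · rintro rfl
              exact hπ0 x hxy
          simp [this], fourier_single_zero B⟩
        (by
          rintro _ _ ⟨f, hf, rfl⟩ ⟨g, hg, rfl⟩
          exact ⟨conv f g, hconv f hf g hg, fourier_conv B f g⟩)
    have hle : fiberConst τ ≤ (fiberConst π).map (fourier B) := by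
      intro g hg
      refine (mem_subalgebra_of_separates A g fun b b' h => hg b b' (hsep b b' fun f hf => ?_) :
        g ∈ A)
      exact h _ ⟨f, hf, rfl⟩
    have heq := Submodule.eq_of_le_of_finrank_eq hle hrank.symm
    intro b b' hb f hf
    have : fourier B f ∈ fiberConst τ := heq ▸ Submodule.mem_map_of_mem hf
    exact this b b' hb
  · intro hconst
    have hle : (fiberConst π).map (fourier B) ≤ fiberConst τ := by
      rintro _ ⟨f, hf, rfl⟩ b b' hb
      exact hconst b b' hb f hf
    have heq := Submodule.eq_of_le_of_finrank_eq hle hrank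
    intro f hf g hg
    have hmul : fourier B f * fourier B g ∈ (fiberConst π).map (fourier B) := by
      rw [heq]
      intro b b' hb
      simp [hconst b b' hb f hf, hconst b b' hb g hg]
    obtain ⟨h, hh, hfg⟩ := hmul
    rw [← fourier_conv] at hfg
    rwa [← fourier_injective hB hfg]

end Criterion

/-! ### The association scheme as closure under convolution -/

section Scheme

variable {V W : Type*} [AddCommGroup V]

open Classical in
/-- The class of a difference `x`: `none` for `x = 0`, and `F x` otherwise. -/
def classMap (F : V → W) (x : V) : Option (punctImage F) :=
  if h : x = 0 then none else some ⟨F x, x, h, rfl⟩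

theorem classMap_zero (F : V → W) : classMap F 0 = none := by simp [classMap]

theorem classMap_eq_none {F : V → W} {x : V} : classMap F x = none ↔ x = 0 := by
  simp [classMap]

theorem classMap_eq_some {F : V → W} {x : V} {i : punctImage F} :
    classMap F x = some i ↔ x ≠ 0 ∧ F x = i := by
  by_cases h : x = 0 <;> simp [classMap, h, Subtype.ext_iff]

theorem map_eq_of_classMap_eq {F : V → W} {x y : V} (h : classMap F x = classMap F y) :
    F x = F y := by
  by_cases hx : x = 0
  · subst hx
    rw [classMap_zero] at h
    rw [classMap_eq_none.1 h.symm]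
  · have h1 : classMap F x = some ⟨F x, x, hx, rfl⟩ := classMap_eq_some.2 ⟨hx, rfl⟩
    rw [h1] at h
    exact (classMap_eq_some.1 h.symm).2.symm

theorem classMap_surjective (F : V → W) : Function.Surjective (classMap F) := by
  rintro (_ | ⟨_, x, hx, rfl⟩)
  · exact ⟨0, classMap_zero F⟩
  · exact ⟨x, classMap_eq_some.2 ⟨hx, rfl⟩⟩

theorem mem_translationRel {F : V → W} {k : Option (punctImage F)} {q : V × V} :
    q ∈ translationRel F k ↔ classMap F (q.1 - q.2) = k := by
  cases k with
  | none => simp [translationRel, classMap_eq_none, sub_eq_zero]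
  | some i => simp [translationRel, classMap_eq_some, and_comm]

variable [Fintype V]

theorem isAssociationScheme_iff_conv (F : V → W) (hF : ∀ x, F x = F (-x)) :
    IsAssociationScheme (punctImage F).ncard (translationRel F) ↔
      ∀ f ∈ fiberConst (classMap F), ∀ g ∈ fiberConst (classMap F),
        conv f g ∈ fiberConst (classMap F) := by
  classical
  have : Finite (punctImage F) := (Set.toFinite {x : V | x ≠ 0}).image F
  have := Fintype.ofFinite (punctImage F)
  -- The intersection number at `q` depends on `q.1 - q.2` only.
  have hshift : ∀ i j (q : V × V),
      {z | (q.1, z) ∈ translationRel F i ∧ (z, q.2) ∈ translationRel F j}.ncard =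
        #{z | classMap F (q.1 - q.2 - z) = i ∧ classMap F z = j} := by
    intro i j q
    rw [← Set.ncard_coe_finset, ← Set.ncard_image_of_injective _ (sub_left_injective (b := q.2))]
    congr 1
    ext z
    simp only [mem_translationRel, Set.mem_image, Set.mem_ofPred_eq, coe_filter, mem_univ, true_and]
    constructor
    · rintro ⟨y, ⟨h1, h2⟩, rfl⟩
      exact ⟨by rw [← h1]; congr 1; abel, h2⟩
    · rintro ⟨h1, h2⟩
      exact ⟨z + q.2, ⟨by rw [← h1]; congr 1; abel, by rw [← h2]; congr 1; abel⟩, by abel⟩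
  have hind : ∀ i j x,
      conv (fun y => if classMap F y = i then 1 else 0) (fun y => if classMap F y = j then 1 else 0)
        x = (#{z | classMap F (x - z) = i ∧ classMap F z = j} : ℂ) := by
    intro i j x
    simp [conv, ← ite_and, and_comm]
  constructor
  · intro hS
    have hint : ∀ i j x y, classMap F x = classMap F y →
        (#{z | classMap F (x - z) = i ∧ classMap F z = j} : ℂ) =
          #{z | classMap F (y - z) = i ∧ classMap F z = j} := by
      intro i j x y hxy
      have h := hS.intersection (classMap F x) i j (x, 0) (mem_translationRel.2 (by simp))
        (y, 0) (mem_translationRel.2 (by simp [hxy]))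
      rw [hshift, hshift] at h
      simpa using h
    intro f hf g hg
    have hfac : ∀ f ∈ fiberConst (classMap F), ∃ a : Option (punctImage F) → ℂ,
        f = ∑ i, a i • fun y => if classMap F y = i then (1 : ℂ) else 0 := by
      intro f hf
      refine ⟨fun i => f (classMap_surjective F i).choose, ?_⟩
      ext x
      simp only [Finset.sum_apply, Pi.smul_apply, smul_eq_mul, mul_ite, mul_one, mul_zero]
      rw [sum_ite_eq, if_pos (mem_univ _)]
      exact hf _ _ (classMap_surjective F (classMap F x)).choose_spec.symm
    obtain ⟨a, ha⟩ := hfac f hf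
    obtain ⟨b, hb⟩ := hfac g hg
    have hsum : ∀ x, conv f g x = ∑ i, ∑ j, a i * b j *
        (#{z | classMap F (x - z) = i ∧ classMap F z = j} : ℂ) := by
      intro x
      simp only [← hind, conv, mul_sum]
      rw [ha, hb]
      simp only [Finset.sum_apply, Pi.smul_apply, smul_eq_mul, sum_mul_sum]
      rw [sum_comm]
      refine sum_congr rfl fun i _ => ?_
      rw [sum_comm]
      refine sum_congr rfl fun j _ => sum_congr rfl fun z _ => ?_
      ring
    intro x y hxy
    rw [hsum, hsum]
    exact sum_congr rfl fun i _ => sum_congr rfl fun j _ => by rw [hint i j x y hxy]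
  · intro hconv
    refine ⟨inferInstance, Nat.card_coe_set_eq _, inferInstance, ⟨0⟩, fun i => ?_, rfl, ?_, ?_,
      fun i => ⟨i, ?_⟩, ?_⟩
    · obtain ⟨x, hx⟩ := classMap_surjective F i
      exact ⟨(x, 0), mem_translationRel.2 (by simpa using hx)⟩
    · exact Set.eq_univ_of_forall fun q => Set.mem_iUnion.2 ⟨_, mem_translationRel.2 rfl⟩
    · intro i j hij
      refine Set.eq_empty_of_forall_notMem fun q hq => hij ?_
      exact (mem_translationRel.1 hq.1).symm.trans (mem_translationRel.1 hq.2)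
    · ext q
      simp only [Set.mem_ofPred_eq, mem_translationRel]
      have hneg : classMap F (q.2 - q.1) = classMap F (q.1 - q.2) := by
        rw [← neg_sub]
        generalize q.1 - q.2 = x
        by_cases hx : x = 0
        · simp [hx]
        · exact (classMap_eq_some.2 ⟨neg_ne_zero.2 hx, (hF x).symm⟩).trans
            (classMap_eq_some (i := ⟨F x, x, hx, rfl⟩).2 ⟨hx, rfl⟩).symm
      rw [hneg]
    · intro k i j q hq q' hq'
      rw [mem_translationRel] at hq hq'
      rw [hshift, hshift]
      have h := hconv (fun y => if classMap F y = i then 1 else 0)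
        (fun x y h => by simp only [h]) (fun y => if classMap F y = j then 1 else 0)
        (fun x y h => by simp only [h]) (q.1 - q.2) (q'.1 - q'.2) (hq.trans hq'.symm)
      rw [hind, hind] at h
      exact_mod_cast h

end Scheme

/-! ### Fibres of vectorial bent functions -/

theorem card_eq_pow (p : ℕ) [Fact p.Prime] (W : Type*) [AddCommGroup W] [Module (ZMod p) W]
    [Fintype W] : Fintype.card W = p ^ Module.finrank (ZMod p) W := by
  rw [Module.card_eq_pow_finrank (K := ZMod p), ZMod.card]

section HalfPow

variable {p : ℕ} [Fact p.Prime]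
variable {V : Type*} [AddCommGroup V] [Module (ZMod p) V]
variable {W : Type*} [AddCommGroup W] [Module (ZMod p) W]

variable (p) in
theorem one_lt_sqrt_prime : 1 < √(p : ℝ) :=
  Real.lt_sqrt_of_sq_lt (by simpa using (Fact.out : p.Prime).one_lt)

variable (p V) in
theorem halfPow_pos : 0 < halfPow p V :=
  pow_pos (zero_lt_one.trans (one_lt_sqrt_prime p)) _

variable (p V) in
theorem halfPow_sq [Fintype V] : halfPow p V ^ 2 = Fintype.card V := by
  rw [halfPow, ← pow_mul, mul_comm, pow_mul, Real.sq_sqrt (Nat.cast_nonneg p), card_eq_pow p V,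
    Nat.cast_pow]

variable (p W) in
theorem card_eq_sqrt_pow [Fintype W] :
    (Fintype.card W : ℝ) = √(p : ℝ) ^ (2 * Module.finrank (ZMod p) W) := by
  rw [pow_mul, Real.sq_sqrt (Nat.cast_nonneg p), card_eq_pow p W, Nat.cast_pow]

theorem card_le_halfPow [Fintype W]
    (hmn : 2 * Module.finrank (ZMod p) W ≤ Module.finrank (ZMod p) V) :
    (Fintype.card W : ℝ) ≤ halfPow p V := by
  rw [card_eq_sqrt_pow p W]
  exact pow_le_pow_right₀ (one_lt_sqrt_prime p).le hmn

theorem halfPow_eq_card_iff [Fintype W] :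
    halfPow p V = Fintype.card W ↔
      2 * Module.finrank (ZMod p) W = Module.finrank (ZMod p) V := by
  rw [card_eq_sqrt_pow p W, halfPow]
  exact (pow_right_injective₀ (zero_lt_one.trans (one_lt_sqrt_prime p))
    (one_lt_sqrt_prime p).ne').eq_iff.trans eq_comm

theorem card_eq_mul_self [Fintype V] {M : ℕ} (h : halfPow p V = M) :
    (Fintype.card V : ℂ) = M * M := by
  have hsq := halfPow_sq p V
  rw [h] at hsq
  rw [← pow_two]
  exact_mod_cast hsq.symm

theorem nontrivial_of_finrank (h2m : 2 ≤ Module.finrank (ZMod p) W)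
    (hmn : 2 * Module.finrank (ZMod p) W ≤ Module.finrank (ZMod p) V) : Nontrivial V :=
  Module.nontrivial_of_finrank_pos (R := ZMod p) (by omega)

theorem norm_stdAddChar (j : ZMod p) : ‖(ZMod.stdAddChar j : ℂ)‖ = 1 :=
  AddChar.norm_apply _ _

theorem norm_walsh_mul [Fintype V] {BV : LinearMap.BilinForm (ZMod p) V}
    {BW : LinearMap.BilinForm (ZMod p) W} {H : V → W} (hH : IsVectorialBent BV BW H)
    (c : {c : W // c ≠ 0}) (b : V) (j : ZMod p) :
    ‖walsh BV (component BW H c) b * ZMod.stdAddChar j‖ = halfPow p V := by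
  rw [norm_mul, norm_stdAddChar, mul_one, hH c c.2 b]

open Classical in
theorem walsh_component_zero [Fintype V] {BV : LinearMap.BilinForm (ZMod p) V}
    (hBV : IsInnerProduct BV)
    (BW : LinearMap.BilinForm (ZMod p) W) (H : V → W) (b : V) :
    walsh BV (component BW H 0) b = if b = 0 then (Fintype.card V : ℂ) else 0 := by
  rw [← fourier_one hBV, walsh_eq_fourier]
  refine congrFun (congrArg _ (funext fun x => ?_)) b
  simp [component]

end HalfPow

section Fibres

variable {p : ℕ} [Fact p.Prime]
variable {V : Type*} [AddCommGroup V] [Module (ZMod p) V] [Fintype V]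
variable {W : Type*} [AddCommGroup W] [Module (ZMod p) W] [Fintype W]

open Classical in
/-- Fourier inversion over the components: the nontrivial components of `H` determine the
transform of the indicator of a fibre of `H`. -/
theorem sum_walsh_component {BV : LinearMap.BilinForm (ZMod p) V} (hBV : IsInnerProduct BV)
    {BW : LinearMap.BilinForm (ZMod p) W} (hBW : IsInnerProduct BW) (H : V → W) (b : V) (i : W) :
    (if b = 0 then (Fintype.card V : ℂ) else 0) +
      ∑ c : {c : W // c ≠ 0}, walsh BV (component BW H c) b * ZMod.stdAddChar (-(BW c i)) =
      Fintype.card W * ∑ x with H x = i, ZMod.stdAddChar (-(BV b x)) := by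
  have h0 : (if b = 0 then (Fintype.card V : ℂ) else 0) =
      walsh BV (component BW H 0) b * ZMod.stdAddChar (-(BW 0 i)) := by
    rw [walsh_component_zero hBV]
    simp
  rw [h0, ← Fintype.sum_eq_add_sum_subtype_ne
    (fun c : W => walsh BV (component BW H c) b * (ZMod.stdAddChar (-(BW c i)) : ℂ)) 0]
  simp only [walsh, sum_mul]
  rw [sum_comm, mul_sum, sum_filter]
  refine sum_congr rfl fun x _ => ?_
  have h := sum_stdAddChar hBW (H x - i)
  rw [sub_eq_zero] at h
  have hc : ∀ c, (ZMod.stdAddChar (component BW H c x - BV b x) : ℂ) *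
      ZMod.stdAddChar (-(BW c i)) =
      ZMod.stdAddChar (-(BV b x)) * ZMod.stdAddChar (BW (H x - i) c) := by
    intro c
    rw [← AddChar.map_add_eq_mul, ← AddChar.map_add_eq_mul, component, hBW.1.eq (H x - i) c,
      map_sub]
    congr 1
    ring
  simp only [hc]
  rw [← mul_sum, h]
  split_ifs <;> ring

open Classical in
theorem card_add_sum_walsh_component {BV : LinearMap.BilinForm (ZMod p) V}
    (hBV : IsInnerProduct BV) {BW : LinearMap.BilinForm (ZMod p) W} (hBW : IsInnerProduct BW)
    (H : V → W) (i : W) :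
    (Fintype.card V : ℂ) +
      ∑ c : {c : W // c ≠ 0}, walsh BV (component BW H c) 0 * ZMod.stdAddChar (-(BW c i)) =
      Fintype.card W * #{x | H x = i} := by
  simpa using sum_walsh_component hBV hBW H 0 i

open Classical in
theorem card_ne_zero_subtype_cast (W : Type*) [Zero W] [Fintype W] (K : Type*) [Ring K] :
    (Fintype.card {c : W // c ≠ 0} : K) = Fintype.card W - 1 := by
  classical
  rw [Fintype.card_subtype_compl, Fintype.card_subtype_eq,
    Nat.cast_sub (Fintype.card_pos (α := W)), Nat.cast_one]

theorem IsVectorialBent.surjective {BV : LinearMap.BilinForm (ZMod p) V}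
    (hBV : IsInnerProduct BV) {BW : LinearMap.BilinForm (ZMod p) W} (hBW : IsInnerProduct BW)
    (hmn : 2 * Module.finrank (ZMod p) W ≤ Module.finrank (ZMod p) V)
    {H : V → W} (hH : IsVectorialBent BV BW H) : Function.Surjective H := by
  classical
  intro i
  by_contra! hi
  have h := card_add_sum_walsh_component hBV hBW H i
  rw [filter_eq_empty_iff.2 fun x _ => hi x, card_empty, Nat.cast_zero, mul_zero,
    add_eq_zero_iff_eq_neg] at h
  have hle : ‖(Fintype.card V : ℂ)‖ ≤ (Fintype.card W - 1) * halfPow p V := by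
    rw [h, norm_neg]
    refine (norm_sum_le _ _).trans_eq ?_
    simp only [norm_walsh_mul hH]
    rw [sum_const, nsmul_eq_mul, card_univ, card_ne_zero_subtype_cast W ℝ]
  rw [Complex.norm_natCast, ← halfPow_sq p V] at hle
  have h1 := card_le_halfPow hmn
  nlinarith [halfPow_pos p V]

theorem eq_neg_of_sum_eq {ι : Type*} [Fintype ι] {z : ι → ℂ} {r : ℝ} (hz : ∀ i, ‖z i‖ = r)
    (hsum : Fintype.card ι * -r ≥ (∑ i, z i).re) (i : ι) : z i = -r := by
  have hre : ∀ i ∈ univ, -r ≤ (z i).re := fun i _ => by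
    have := (abs_le.1 (Complex.abs_re_le_norm (z i))).1
    rwa [hz] at this
  have hs : ∑ i : ι, -r = ∑ i, (z i).re := by
    refine le_antisymm (sum_le_sum hre) ?_
    rw [sum_const, nsmul_eq_mul, card_univ, ← Complex.re_sum]
    exact hsum
  have hi := (sum_eq_sum_iff_of_le hre).1 hs i (mem_univ i)
  have hsq := Complex.sq_norm (z i)
  rw [hz, Complex.normSq_apply, ← hi] at hsq
  have him : (z i).im = 0 := by
    have : (z i).im * (z i).im = 0 := by linarith
    simpa using this
  apply Complex.ext <;> simp [← hi, him]

/-- A fibre of a vectorial bent function can be a single point only in the extreme case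
`2 m = n`, with all the nontrivial terms of the counting formula equal to `-p ^ m`. -/
theorem IsVectorialBent.of_card_fiber_eq_one {BV : LinearMap.BilinForm (ZMod p) V}
    (hBV : IsInnerProduct BV) {BW : LinearMap.BilinForm (ZMod p) W} (hBW : IsInnerProduct BW)
    (hmn : 2 * Module.finrank (ZMod p) W ≤ Module.finrank (ZMod p) V)
    {H : V → W} (hH : IsVectorialBent BV BW H) {i : W} {x₀ : V} (hx₀ : ∀ x, H x = i ↔ x = x₀) :
    2 * Module.finrank (ZMod p) W = Module.finrank (ZMod p) V ∧
      ∀ c : {c : W // c ≠ 0},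
        walsh BV (component BW H c) 0 * ZMod.stdAddChar (-(BW c i)) = -(Fintype.card W : ℂ) := by
  classical
  have h := card_add_sum_walsh_component hBV hBW H i
  have hfib : (univ.filter fun x => H x = i) = {x₀} := by
    ext x
    simp [hx₀]
  rw [hfib, card_singleton, Nat.cast_one, mul_one] at h
  set S := ∑ c : {c : W // c ≠ 0},
    walsh BV (component BW H c) 0 * (ZMod.stdAddChar (-(BW c i)) : ℂ) with hS
  have hre : (Fintype.card V : ℝ) + S.re = Fintype.card W := by
    have := congrArg Complex.re h
    simpa using this
  have hle : ‖S‖ ≤ (Fintype.card W - 1) * halfPow p V := by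
    refine (norm_sum_le _ _).trans_eq ?_
    simp only [norm_walsh_mul hH]
    rw [sum_const, nsmul_eq_mul, card_univ, card_ne_zero_subtype_cast W ℝ]
  have hle' := (abs_le.1 ((Complex.abs_re_le_norm S).trans hle)).1
  have h1 := card_le_halfPow hmn
  have hpos := halfPow_pos p V
  rw [← halfPow_sq p V] at hre
  -- The count gives `(q - M) (q + 1) ≤ 0` for `q = p ^ (n / 2)` and `M = p ^ m`.
  have hq : halfPow p V = Fintype.card W := by
    refine le_antisymm ?_ h1
    by_contra! hlt
    nlinarith [mul_pos (sub_pos.2 hlt) (by linarith : 0 < halfPow p V + 1)]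
  refine ⟨halfPow_eq_card_iff.1 hq, fun c => ?_⟩
  have := eq_neg_of_sum_eq (fun c => norm_walsh_mul hH c 0 (-(BW c i))) (by
    rw [← hS, card_ne_zero_subtype_cast W ℝ]
    nlinarith) c
  rw [this, hq]
  simp

open Classical in
theorem sum_ne_zero_stdAddChar {BW : LinearMap.BilinForm (ZMod p) W}
    (hBW : IsInnerProduct BW) (g : W) :
    ∑ c : {c : W // c ≠ 0}, (ZMod.stdAddChar (BW c g) : ℂ) =
      (if g = 0 then (Fintype.card W : ℂ) else 0) - 1 := by
  classical
  have h := sum_stdAddChar hBW g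
  rw [Fintype.sum_eq_add_sum_subtype_ne _ 0] at h
  simp only [map_zero, AddChar.map_zero_eq_one] at h
  simp only [hBW.1.eq g] at h
  rw [eq_sub_iff_add_eq', h]

theorem four_le_card (h2m : 2 ≤ Module.finrank (ZMod p) W) : 4 ≤ Fintype.card W := by
  rw [card_eq_pow p W]
  calc 4 = 2 ^ 2 := rfl
    _ ≤ p ^ 2 := Nat.pow_le_pow_left (Fact.out : p.Prime).two_le 2
    _ ≤ _ := Nat.pow_le_pow_right (Fact.out : p.Prime).pos h2m

theorem exists_stdAddChar_ne_neg_one {BW : LinearMap.BilinForm (ZMod p) W}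
    (hBW : IsInnerProduct BW) (h2m : 2 ≤ Module.finrank (ZMod p) W) (g : W) :
    ∃ c : {c : W // c ≠ 0}, (ZMod.stdAddChar (BW c g) : ℂ) ≠ -1 := by
  classical
  by_contra! h
  have hs := sum_ne_zero_stdAddChar hBW g
  simp only [h] at hs
  rw [sum_const, nsmul_eq_mul, card_univ, card_ne_zero_subtype_cast W ℂ] at hs
  have h4 := four_le_card (p := p) h2m
  split_ifs at hs with hg
  · have : (Fintype.card W : ℂ) = 1 := by linear_combination (-1 / 2) * hs
    have : Fintype.card W = 1 := by exact_mod_cast this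
    omega
  · have : (Fintype.card W : ℂ) = 2 := by linear_combination -hs
    have : Fintype.card W = 2 := by exact_mod_cast this
    omega

end Fibres

/-! ### Admissible factors and congruences modulo two -/

theorem IsAdmissibleFactor.ne_zero {p n : ℕ} {ε : ℂ} (h : IsAdmissibleFactor p n ε) : ε ≠ 0 := by
  unfold IsAdmissibleFactor at h
  split_ifs at h
  · simp [h]
  · rcases h with rfl | rfl <;> simp
  · rcases h with rfl | rfl <;> simp

theorem IsAdmissibleFactor.eq_or_eq_neg {p n : ℕ} (hp : p ≠ 2) (hn : Even n) {ε : ℂ}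
    (h : IsAdmissibleFactor p n ε) : ε = 1 ∨ ε = -1 := by
  unfold IsAdmissibleFactor at h
  rwa [if_neg hp, if_pos (Or.inr hn)] at h

section Factors

variable {p : ℕ} [Fact p.Prime]

/-- A product of an admissible factor and a `p`-th root of unity determines both: for odd `p` two
admissible factors differ by a sign, and `-1` is not a `p`-th root of unity. -/
theorem IsAdmissibleFactor.unique {n : ℕ} {ε ε' : ℂ} (h : IsAdmissibleFactor p n ε)
    (h' : IsAdmissibleFactor p n ε') {j j' : ZMod p}
    (he : ε * ZMod.stdAddChar j = ε' * ZMod.stdAddChar j') : ε = ε' ∧ j = j' := by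
  have key : ε = ε' := by
    by_cases hp : p = 2
    · rw [IsAdmissibleFactor, if_pos hp] at h h'
      rw [h, h']
    · have hodd : Odd p := (Fact.out : p.Prime).odd_of_ne_two hp
      have hsign : ε' = ε ∨ ε' = -ε := by
        unfold IsAdmissibleFactor at h h'
        rw [if_neg hp] at h h'
        split_ifs at h h' <;> rcases h with rfl | rfl <;> rcases h' with rfl | rfl <;> simp
      rcases hsign with hs | hs
      · exact hs.symm
      · exfalso
        have hpow : ∀ k : ZMod p, (ZMod.stdAddChar k : ℂ) ^ p = 1 := fun k => by
          rw [← AddChar.map_nsmul_eq_pow]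
          simp
        have h1 : (ZMod.stdAddChar j : ℂ) = -ZMod.stdAddChar j' := by
          apply mul_left_cancel₀ h.ne_zero
          rw [he, hs]
          ring
        have h2 := hpow j
        rw [h1, hodd.neg_pow, hpow] at h2
        norm_num at h2
  subst key
  exact ⟨rfl, ZMod.injective_stdAddChar (mul_left_cancel₀ h.ne_zero he)⟩

/-- The algebraic integers divisible by two. -/
def evenIntegers : AddSubgroup ℂ where
  carrier := {z | ∃ w, IsIntegral ℤ w ∧ z = 2 * w}
  add_mem' := by
    rintro _ _ ⟨a, ha, rfl⟩ ⟨b, hb, rfl⟩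
    exact ⟨a + b, ha.add hb, by ring⟩
  zero_mem' := ⟨0, isIntegral_zero, by ring⟩
  neg_mem' := by
    rintro _ ⟨a, ha, rfl⟩
    exact ⟨-a, ha.neg, by ring⟩

theorem intCast_mem_evenIntegers {k : ℤ} (h : (k : ℂ) ∈ evenIntegers) : Even k := by
  obtain ⟨w, hw, hk⟩ := h
  have hw' : w = algebraMap ℚ ℂ (k / 2) := by
    rw [map_div₀, map_intCast, map_ofNat, hk]
    ring
  rw [hw', isIntegral_algebraMap_iff (algebraMap ℚ ℂ).injective,
    IsIntegrallyClosed.isIntegral_iff] at hw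
  obtain ⟨y, hy⟩ := hw
  refine ⟨y, ?_⟩
  have : (k : ℚ) = y + y := by
    rw [eq_intCast] at hy
    rw [hy]
    ring
  exact_mod_cast this

theorem isIntegral_stdAddChar (j : ZMod p) : IsIntegral ℤ (ZMod.stdAddChar j : ℂ) := by
  refine IsIntegral.of_pow (Fact.out : p.Prime).pos ?_
  rw [← AddChar.map_nsmul_eq_pow]
  simpa using isIntegral_one

end Factors

/-! ### The image of a vectorial dual-bent function and of its dual -/

section Dual

variable {p : ℕ} [Fact p.Prime]
variable {V : Type*} [AddCommGroup V] [Module (ZMod p) V] [Fintype V]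
variable {W : Type*} [AddCommGroup W] [Module (ZMod p) W]
variable {BV : LinearMap.BilinForm (ZMod p) V} {BW : LinearMap.BilinForm (ZMod p) W}
variable {F G : V → W} {σ : Equiv.Perm {c : W // c ≠ 0}}

/-- A function whose `dual` is bent does have a dual: otherwise `dual` takes the default value
`0`, and the zero function is not bent. -/
theorem isDual_dual_of_isBent [Nontrivial V] (hBV : IsInnerProduct BV) {f : V → ZMod p}
    (hf : IsBent BV (dual BV f)) : IsDual BV f (dual BV f) := by
  classical
  by_cases h : ∃ g, IsDual BV f g
  · rw [dual, dif_pos h]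
    exact h.choose_spec
  · rw [dual, dif_neg h] at hf
    obtain ⟨a, ha⟩ := exists_ne (0 : V)
    have h0 : walsh BV 0 a = 0 := by
      rw [walsh_eq_fourier]
      have h1 := fourier_one hBV a
      rw [if_neg ha] at h1
      rw [← h1]
      refine congrFun (congrArg _ (funext fun x => ?_)) a
      simp
    have := hf a
    rw [h0, norm_zero] at this
    exact absurd this (halfPow_pos p V).ne

theorem eps_eq {f : V → ZMod p} {b : V} {ε : ℂ}
    (h : walsh BV f b = ε * (halfPow p V : ℂ) * ZMod.stdAddChar (dual BV f b)) :
    eps BV f b = ε := by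
  have hq : (halfPow p V : ℂ) ≠ 0 := Complex.ofReal_ne_zero.2 (halfPow_pos p V).ne'
  have h1 : (ZMod.stdAddChar (-dual BV f b) : ℂ) * ZMod.stdAddChar (dual BV f b) = 1 := by
    rw [← AddChar.map_add_eq_mul, neg_add_cancel, AddChar.map_zero_eq_one]
  rw [eps, h]
  field_simp
  linear_combination ε * h1

theorem walsh_eq_eps [Nontrivial V] (hBV : IsInnerProduct BV) (hG : IsVectorialBent BV BW G)
    (hσ : ∀ c : {c : W // c ≠ 0}, dual BV (component BW F c) = component BW G (σ c))
    (c : {c : W // c ≠ 0}) (b : V) :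
    IsAdmissibleFactor p (Module.finrank (ZMod p) V) (eps BV (component BW F c) b) ∧
      walsh BV (component BW F c) b =
        eps BV (component BW F c) b * (halfPow p V : ℂ) * ZMod.stdAddChar (BW (σ c) (G b)) := by
  have hd : IsDual BV (component BW F c) (dual BV (component BW F c)) := by
    apply isDual_dual_of_isBent hBV
    rw [hσ]
    exact hG _ (σ c).2
  obtain ⟨ε, hε, hw⟩ := hd b
  rw [eps_eq hw]
  refine ⟨hε, ?_⟩
  rw [hw, hσ]
  rfl

theorem prime_ne_two_of_eps_zero (hBV : IsInnerProduct BV) (h2m : 2 ≤ Module.finrank (ZMod p) W)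
    (hmn : 2 * Module.finrank (ZMod p) W ≤ Module.finrank (ZMod p) V)
    (hG : IsVectorialBent BV BW G)
    (hσ : ∀ c : {c : W // c ≠ 0}, dual BV (component BW F c) = component BW G (σ c))
    (heps : ∀ c : W, c ≠ 0 → eps BV (component BW F c) 0 = -1) : p ≠ 2 := by
  intro hp
  have := nontrivial_of_finrank (V := V) h2m hmn
  have : Nontrivial W := Module.nontrivial_of_finrank_pos (R := ZMod p) (by omega)
  obtain ⟨c, hc⟩ := exists_ne (0 : W)
  have h1 := (walsh_eq_eps hBV hG hσ ⟨c, hc⟩ 0).1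
  rw [IsAdmissibleFactor, if_pos hp, heps c hc] at h1
  norm_num at h1

variable [Fintype W]

/-- If `0` is the only zero of `F`, then `n = 2 m` and all factors at `0` are `-1`. -/
theorem eps_zero_eq_neg_one (hBV : IsInnerProduct BV) (hBW : IsInnerProduct BW)
    (h2m : 2 ≤ Module.finrank (ZMod p) W)
    (hmn : 2 * Module.finrank (ZMod p) W ≤ Module.finrank (ZMod p) V)
    (hF : IsVectorialBent BV BW F) (hG : IsVectorialBent BV BW G)
    (hσ : ∀ c : {c : W // c ≠ 0}, dual BV (component BW F c) = component BW G (σ c))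
    (hfib : ∀ x, F x = 0 ↔ x = 0) :
    2 * Module.finrank (ZMod p) W = Module.finrank (ZMod p) V ∧
      ∀ c : W, c ≠ 0 → eps BV (component BW F c) 0 = -1 := by
  have := nontrivial_of_finrank (V := V) h2m hmn
  obtain ⟨hdim, hval⟩ := hF.of_card_fiber_eq_one hBV hBW hmn hfib
  refine ⟨hdim, ?_⟩
  have hprod : ∀ c : {c : W // c ≠ 0}, eps BV (component BW F c) 0 *
      ZMod.stdAddChar (BW (σ c) (G 0)) = -1 := by
    intro c
    have h := hval c
    rw [map_zero, neg_zero, AddChar.map_zero_eq_one, mul_one, (walsh_eq_eps hBV hG hσ c 0).2,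
      halfPow_eq_card_iff.2 hdim, Complex.ofReal_natCast] at h
    have hM : (Fintype.card W : ℂ) ≠ 0 := Nat.cast_ne_zero.2 Fintype.card_ne_zero
    apply mul_left_cancel₀ hM
    linear_combination h
  by_cases hp : p = 2
  · -- For `p = 2` all factors are `1`, so all characters at `G 0` would take the value `-1`.
    exfalso
    obtain ⟨d, hd⟩ := exists_stdAddChar_ne_neg_one hBW h2m (G 0)
    have h := hprod (σ.symm d)
    have h1 := (walsh_eq_eps hBV hG hσ (σ.symm d) 0).1
    rw [IsAdmissibleFactor, if_pos hp] at h1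
    rw [h1, one_mul, Equiv.apply_symm_apply] at h
    exact hd h
  · intro c hc
    have hadm : IsAdmissibleFactor p (Module.finrank (ZMod p) V) (-1) := by
      rw [IsAdmissibleFactor, if_neg hp, if_pos (Or.inr (hdim ▸ even_two_mul _))]
      exact Or.inr rfl
    refine ((walsh_eq_eps hBV hG hσ ⟨c, hc⟩ 0).1.unique hadm
      (j := BW (σ ⟨c, hc⟩) (G 0)) (j' := 0) ?_).1
    rw [hprod, AddChar.map_zero_eq_one, mul_one]

/-- In the exceptional case the fibre of `F` over `0` has `1` or `p ^ m + 1` elements, according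
to whether `G 0` vanishes. As `F` is even and `p` is odd, the number is odd. -/
theorem fiber_zero_of_eps_zero (hBV : IsInnerProduct BV) (hBW : IsInnerProduct BW)
    (h2m : 2 ≤ Module.finrank (ZMod p) W)
    (hdim : 2 * Module.finrank (ZMod p) W = Module.finrank (ZMod p) V)
    (hF0 : F 0 = 0) (hFeven : ∀ x, F x = F (-x)) (hG : IsVectorialBent BV BW G)
    (hσ : ∀ c : {c : W // c ≠ 0}, dual BV (component BW F c) = component BW G (σ c))
    (heps : ∀ c : W, c ≠ 0 → eps BV (component BW F c) 0 = -1) :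
    (∀ x, F x = 0 ↔ x = 0) ∧ G 0 = 0 := by
  classical
  have := nontrivial_of_finrank (V := V) h2m hdim.le
  have hp := prime_ne_two_of_eps_zero hBV h2m hdim.le hG hσ heps
  have hodd : Odd p := (Fact.out : p.Prime).odd_of_ne_two hp
  have hcount := card_add_sum_walsh_component hBV hBW F 0
  have hq := halfPow_eq_card_iff.2 hdim
  have hterm : ∀ c : {c : W // c ≠ 0}, walsh BV (component BW F c) 0 *
      (ZMod.stdAddChar (-(BW c 0)) : ℂ) =
      -(Fintype.card W * ZMod.stdAddChar (BW (σ c) (G 0))) := by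
    intro c
    rw [(walsh_eq_eps hBV hG hσ c 0).2, heps c c.2, hq, map_zero, neg_zero,
      AddChar.map_zero_eq_one, Complex.ofReal_natCast]
    ring
  have hM : (Fintype.card W : ℂ) ≠ 0 := Nat.cast_ne_zero.2 Fintype.card_ne_zero
  have hV : (Fintype.card V : ℂ) = Fintype.card W * Fintype.card W :=
    card_eq_mul_self hq
  have hcard : (#{x | F x = 0} : ℂ) =
      Fintype.card W - ((if G 0 = 0 then (Fintype.card W : ℂ) else 0) - 1) := by
    apply mul_left_cancel₀ hM
    rw [← hcount, ← sum_ne_zero_stdAddChar hBW, hV]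
    simp only [hterm]
    rw [sum_neg_distrib, ← mul_sum,
      Equiv.sum_comp σ fun d : {c : W // c ≠ 0} => (ZMod.stdAddChar (BW d (G 0)) : ℂ)]
    ring
  by_cases hG0 : G 0 = 0
  · rw [if_pos hG0] at hcard
    have h1 : #{x | F x = 0} = 1 := by
      have : (#{x | F x = 0} : ℂ) = 1 := by rw [hcard]; ring
      exact_mod_cast this
    obtain ⟨a, ha⟩ := card_eq_one.1 h1
    have hmem : ∀ x, F x = 0 ↔ x = a := fun x => by
      have := congrArg (x ∈ ·) ha
      simpa using this
    obtain rfl := (hmem 0).1 hF0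
    exact ⟨hmem, hG0⟩
  · exfalso
    rw [if_neg hG0] at hcard
    have h1 : #{x | F x = 0} = Fintype.card W + 1 := by
      have : (#{x | F x = 0} : ℂ) = Fintype.card W + 1 := by rw [hcard]; ring
      exact_mod_cast this
    have hpair : ∑ x ∈ ({x | F x = 0} : Finset V).erase 0, (1 : ZMod 2) = 0 := by
      refine sum_involution (fun x _ => -x) (fun _ _ => by decide) (fun x hx _ hneg => ?_)
        (fun x hx => ?_) (fun x _ => neg_neg x)
      · have h2 : (2 : ZMod p) • x = 0 := by
          rw [two_smul]
          nth_rewrite 1 [← hneg]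
          exact neg_add_cancel x
        have h20 : (2 : ZMod p) ≠ 0 := by
          intro h
          have := (ZMod.natCast_eq_zero_iff 2 p).1 (by exact_mod_cast h)
          exact hp ((Nat.prime_dvd_prime_iff_eq Fact.out Nat.prime_two).1 this)
        exact (mem_erase.1 hx).1 ((smul_eq_zero.1 h2).resolve_left h20)
      · simp only [mem_erase, mem_filter_univ, neg_ne_zero] at hx ⊢
        exact ⟨hx.1, (hFeven x).symm.trans hx.2⟩
    rw [sum_const, card_erase_of_mem (by simp [hF0]), h1, Nat.add_sub_cancel, nsmul_eq_mul,
      mul_one, card_eq_pow p W, ZMod.natCast_eq_zero_iff_even] at hpair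
    exact (Nat.not_even_iff_odd.2 hodd.pow) hpair

theorem dual_ne_zero_of_eps_zero (hBV : IsInnerProduct BV) (hBW : IsInnerProduct BW)
    (h2m : 2 ≤ Module.finrank (ZMod p) W)
    (hdim : 2 * Module.finrank (ZMod p) W = Module.finrank (ZMod p) V)
    (hF0 : F 0 = 0) (hFeven : ∀ x, F x = F (-x)) (hG : IsVectorialBent BV BW G)
    (hσ : ∀ c : {c : W // c ≠ 0}, dual BV (component BW F c) = component BW G (σ c))
    (heps : ∀ c : W, c ≠ 0 → eps BV (component BW F c) 0 = -1) {b : V} (hb : b ≠ 0) :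
    G b ≠ 0 := by
  classical
  intro hGb
  have := nontrivial_of_finrank (V := V) h2m hdim.le
  have hp := prime_ne_two_of_eps_zero hBV h2m hdim.le hG hσ heps
  have hodd : Odd p := (Fact.out : p.Prime).odd_of_ne_two hp
  obtain ⟨hfib, -⟩ := fiber_zero_of_eps_zero hBV hBW h2m hdim hF0 hFeven hG hσ heps
  have hsum := sum_walsh_component hBV hBW F b 0
  have hfib' : (univ.filter fun x => F x = 0) = {0} := by
    ext x
    simp [hfib]
  rw [if_neg hb, zero_add, hfib', sum_singleton, map_zero, neg_zero,
    AddChar.map_zero_eq_one] at hsum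
  have hM : (Fintype.card W : ℂ) ≠ 0 := Nat.cast_ne_zero.2 Fintype.card_ne_zero
  have hone : ∑ c : {c : W // c ≠ 0}, eps BV (component BW F c) b = 1 := by
    apply mul_left_cancel₀ hM
    rw [← hsum, mul_sum]
    refine sum_congr rfl fun c _ => ?_
    rw [(walsh_eq_eps hBV hG hσ c b).2, hGb, halfPow_eq_card_iff.2 hdim]
    simp only [map_zero, neg_zero, AddChar.map_zero_eq_one, Complex.ofReal_natCast]
    ring
  -- An even number of signs cannot add up to `1`.
  have heven : (∑ c : {c : W // c ≠ 0}, (1 - eps BV (component BW F c) b)) ∈ evenIntegers := by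
    refine sum_mem fun c _ => ?_
    rcases (walsh_eq_eps hBV hG hσ c b).1.eq_or_eq_neg hp (hdim ▸ even_two_mul _) with h | h
    · rw [h, sub_self]
      exact zero_mem _
    · exact ⟨1, isIntegral_one, by rw [h]; norm_num⟩
  rw [sum_sub_distrib, hone, sum_const, nsmul_eq_mul, card_univ, card_ne_zero_subtype_cast W ℂ,
    mul_one] at heven
  have h2 : Even ((Fintype.card W : ℤ) - 2) :=
    intCast_mem_evenIntegers (by push_cast; convert heven using 1; ring)
  have h3 : Odd (Fintype.card W : ℤ) := by
    rw [card_eq_pow p W]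
    exact_mod_cast hodd.pow
  rcases h2 with ⟨k, hk⟩
  rcases h3 with ⟨l, hl⟩
  omega

/-- If the factors are signs, then the Walsh values of the dual components recover `F` modulo
two. -/
theorem walsh_dual_sub_mem_evenIntegers (hBV : IsInnerProduct BV) (hp : p ≠ 2)
    (h2m : 2 ≤ Module.finrank (ZMod p) W)
    (hdim : 2 * Module.finrank (ZMod p) W = Module.finrank (ZMod p) V)
    (hFeven : ∀ x, F x = F (-x)) (hG : IsVectorialBent BV BW G)
    (hσ : ∀ c : {c : W // c ≠ 0}, dual BV (component BW F c) = component BW G (σ c))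
    (c : {c : W // c ≠ 0}) (x : V) :
    walsh BV (component BW G (σ c)) x - Fintype.card W * ZMod.stdAddChar (component BW F c x) ∈
      evenIntegers := by
  have := nontrivial_of_finrank (V := V) h2m hdim.le
  have hq := halfPow_eq_card_iff.2 hdim
  have hM : (Fintype.card W : ℂ) ≠ 0 := Nat.cast_ne_zero.2 Fintype.card_ne_zero
  have hV : (Fintype.card V : ℂ) = Fintype.card W * Fintype.card W :=
    card_eq_mul_self hq
  have hinv := fourier_inversion hBV (fun y => ZMod.stdAddChar (component BW F c y)) (-x)
  simp only [← walsh_eq_fourier] at hinv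
  have hFc : ∑ b, eps BV (component BW F c) b *
      ZMod.stdAddChar (component BW G (σ c) b - BV x b) =
      Fintype.card W * ZMod.stdAddChar (component BW F c x) := by
    apply mul_left_cancel₀ hM
    rw [← mul_assoc, ← hV]
    have hneg : component BW F c x = component BW F c (-x) := by
      rw [component, component, hFeven]
    rw [hneg, ← hinv, mul_sum]
    refine sum_congr rfl fun b _ => ?_
    rw [(walsh_eq_eps hBV hG hσ c b).2, hq, map_neg, hBV.1.eq b x, sub_eq_add_neg,
      AddChar.map_add_eq_mul, component, Complex.ofReal_natCast]
    ring
  rw [← hFc, walsh, ← sum_sub_distrib]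
  refine sum_mem fun b _ => ?_
  rcases (walsh_eq_eps hBV hG hσ c b).1.eq_or_eq_neg hp (hdim ▸ even_two_mul _) with h | h
  · rw [h, one_mul, sub_self]
    exact zero_mem _
  · exact ⟨_, isIntegral_stdAddChar (component BW G (σ c) b - BV x b), by rw [h]; ring⟩

/-- If `0` is the only point of its fibre under the dual, then it is the only zero of `F`. -/
theorem fiber_zero_of_dual_fiber_zero (hBV : IsInnerProduct BV) (hBW : IsInnerProduct BW)
    (h2m : 2 ≤ Module.finrank (ZMod p) W)
    (hmn : 2 * Module.finrank (ZMod p) W ≤ Module.finrank (ZMod p) V)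
    (hF0 : F 0 = 0) (hFeven : ∀ x, F x = F (-x)) (hG : IsVectorialBent BV BW G)
    (hσ : ∀ c : {c : W // c ≠ 0}, dual BV (component BW F c) = component BW G (σ c))
    (hfib : ∀ x, G x = G 0 ↔ x = 0) (x : V) (hx : F x = 0) : x = 0 := by
  classical
  by_contra hx0
  have := nontrivial_of_finrank (V := V) h2m hmn
  obtain ⟨hdim, hval⟩ := hG.of_card_fiber_eq_one hBV hBW hmn hfib
  have hq := halfPow_eq_card_iff.2 hdim
  have hM : (Fintype.card W : ℂ) ≠ 0 := Nat.cast_ne_zero.2 Fintype.card_ne_zero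
  have hV : (Fintype.card V : ℂ) = Fintype.card W * Fintype.card W :=
    card_eq_mul_self hq
  have hW0 : ∀ d : {c : W // c ≠ 0}, walsh BV (component BW G d) 0 =
      -(Fintype.card W * ZMod.stdAddChar (BW d (G 0))) := by
    intro d
    have h1 : (ZMod.stdAddChar (-(BW d (G 0))) : ℂ) * ZMod.stdAddChar (BW d (G 0)) = 1 := by
      rw [← AddChar.map_add_eq_mul, neg_add_cancel, AddChar.map_zero_eq_one]
    linear_combination (ZMod.stdAddChar (BW d (G 0)) : ℂ) * hval d -
      walsh BV (component BW G d) 0 * h1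
  by_cases hp : p = 2
  · obtain ⟨d, hd⟩ := exists_stdAddChar_ne_neg_one hBW h2m (G 0)
    refine hd ?_
    have hinv := fourier_inversion hBV
      (fun y => ZMod.stdAddChar (component BW F (σ.symm d) y)) 0
    simp only [← walsh_eq_fourier] at hinv
    have hterm : ∀ b, walsh BV (component BW F (σ.symm d)) b =
        Fintype.card W * ZMod.stdAddChar (BW d (G b)) := by
      intro b
      have h := walsh_eq_eps hBV hG hσ (σ.symm d) b
      have h1 := h.1
      rw [IsAdmissibleFactor, if_pos hp] at h1
      rw [h.2, h1, hq, Equiv.apply_symm_apply, Complex.ofReal_natCast, one_mul]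
    have hsum : ∑ b, (ZMod.stdAddChar (BW d (G b)) : ℂ) = walsh BV (component BW G d) 0 := by
      simp [walsh, component]
    simp only [hterm, map_zero, AddChar.map_zero_eq_one, mul_one, component, hF0] at hinv
    rw [← mul_sum, hsum, hW0, hV] at hinv
    apply mul_left_cancel₀ (mul_ne_zero hM hM)
    linear_combination -hinv
  · have hodd : Odd (Fintype.card W : ℤ) := by
      rw [card_eq_pow p W]
      exact_mod_cast ((Fact.out : p.Prime).odd_of_ne_two hp).pow
    have hpar : ¬ Even ((Fintype.card W : ℤ) - (Fintype.card W - 1) * Fintype.card W) := by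
      intro h2
      have h3 := Int.even_mul_succ_self ((Fintype.card W : ℤ) - 1)
      rw [sub_add_cancel] at h3
      have h4 := h2.add h3
      rw [sub_add_cancel] at h4
      exact (Int.not_even_iff_odd.2 hodd) h4
    have hcong : ∀ y, F y = 0 → ∀ d : {c : W // c ≠ 0},
        walsh BV (component BW G d) y - Fintype.card W ∈ evenIntegers := by
      intro y hy d
      have h := walsh_dual_sub_mem_evenIntegers hBV hp h2m hdim hFeven hG hσ (σ.symm d) y
      rwa [Equiv.apply_symm_apply, component, hy, map_zero, AddChar.map_zero_eq_one,
        mul_one] at h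
    -- Summing the congruences at `0` shows that `G 0 = 0`.
    have hG0 : G 0 = 0 := by
      by_contra hne
      have h := sum_mem (fun d (_ : d ∈ univ) => hcong 0 hF0 d)
      simp only [hW0] at h
      rw [sum_sub_distrib, sum_neg_distrib, ← mul_sum, sum_ne_zero_stdAddChar hBW, if_neg hne,
        sum_const, nsmul_eq_mul, card_univ, card_ne_zero_subtype_cast W ℂ] at h
      refine hpar (intCast_mem_evenIntegers ?_)
      push_cast
      convert h using 1
      ring
    -- Summing the congruences at `x` shows that `p ^ m` is even.
    have hsum := sum_walsh_component hBV hBW G x (G 0)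
    have hfib' : (univ.filter fun x => G x = G 0) = {0} := by
      ext x
      simp [hfib]
    rw [if_neg hx0, zero_add, hfib', sum_singleton, map_zero, neg_zero, AddChar.map_zero_eq_one,
      mul_one] at hsum
    simp only [hG0, map_zero, neg_zero, AddChar.map_zero_eq_one, mul_one] at hsum
    have h := sum_mem (fun d (_ : d ∈ univ) => hcong x hx d)
    rw [sum_sub_distrib, hsum, sum_const, nsmul_eq_mul, card_univ,
      card_ne_zero_subtype_cast W ℂ] at h
    refine hpar (intCast_mem_evenIntegers ?_)
    push_cast
    exact h

end Dual

/-! ### The criterion in terms of the factors -/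

theorem punctImage_eq_univ {V W : Type*} [Zero V] {H : V → W} (hs : Function.Surjective H)
    (h : ∃ x, x ≠ 0 ∧ H x = H 0) : punctImage H = Set.univ := by
  refine Set.eq_univ_of_forall fun i => ?_
  obtain ⟨x, rfl⟩ := hs i
  by_cases hx : x = 0
  · obtain ⟨y, hy, hy0⟩ := h
    exact ⟨y, hy, by rw [hy0, hx]⟩
  · exact ⟨x, hx, rfl⟩

theorem punctImage_eq_ne {V W : Type*} [Zero V] {H : V → W} (hs : Function.Surjective H)
    (h : ∀ x, H x = H 0 → x = 0) : punctImage H = {i | i ≠ H 0} := by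
  ext i
  constructor
  · rintro ⟨x, hx, rfl⟩ h0
    exact hx (h x h0)
  · intro hi
    obtain ⟨x, rfl⟩ := hs i
    exact ⟨x, fun hx => hi (by rw [hx]), rfl⟩

theorem ncard_range_classMap {V W : Type*} [AddCommGroup V] [Finite V] (F : V → W) :
    (Set.range (classMap F)).ncard = (punctImage F).ncard + 1 := by
  have : Finite (punctImage F) := (Set.toFinite {x : V | x ≠ 0}).image F
  rw [(classMap_surjective F).range_eq, Set.ncard_univ, Finite.card_option,
    Nat.card_coe_set_eq]

section Scheme

variable {p : ℕ} [Fact p.Prime]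
variable {V : Type*} [AddCommGroup V] [Module (ZMod p) V] [Fintype V]
variable {W : Type*} [AddCommGroup W] [Module (ZMod p) W]
variable {BV : LinearMap.BilinForm (ZMod p) V} {BW : LinearMap.BilinForm (ZMod p) W}
variable {F G : V → W} {σ : Equiv.Perm {c : W // c ≠ 0}}

/-- The Walsh values of the components at two nonzero points determine whether the transforms of
all functions constant on the classes agree there: these functions are spanned by the
characters of `W` composed with `F` and the indicator of `0`. -/
theorem fourier_eq_iff_walsh_eq [Fintype W] (hBV : IsInnerProduct BV)
    (hBW : IsInnerProduct BW) {b b' : V} (hb : b ≠ 0) (hb' : b' ≠ 0) :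
    (∀ f ∈ fiberConst (classMap F), fourier BV f b = fourier BV f b') ↔
      ∀ c : {c : W // c ≠ 0},
        walsh BV (component BW F c) b = walsh BV (component BW F c) b' := by
  classical
  constructor
  · intro h c
    rw [walsh_eq_fourier, walsh_eq_fourier]
    refine h _ fun x y hxy => ?_
    simp only [component, map_eq_of_classMap_eq hxy]
  · intro h f hf
    have hall : ∀ c : W, walsh BV (component BW F c) b = walsh BV (component BW F c) b' := by
      intro c
      by_cases hc : c = 0
      · rw [hc, walsh_component_zero hBV, walsh_component_zero hBV, if_neg hb, if_neg hb']
      · exact h ⟨c, hc⟩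
    let k : W → ℂ := fun w => if hw : w ∈ punctImage F then f hw.choose else 0
    have hk : ∀ x, x ≠ 0 → k (F x) = f x := by
      intro x hx
      have hw : F x ∈ punctImage F := ⟨x, hx, rfl⟩
      simp only [k, dif_pos hw]
      obtain ⟨h1, h2⟩ := hw.choose_spec
      exact hf _ _ ((classMap_eq_some (i := ⟨F x, hw⟩).2 ⟨h1, h2⟩).trans
        (classMap_eq_some.2 ⟨hx, rfl⟩).symm)
    have hM : (Fintype.card W : ℂ) ≠ 0 := Nat.cast_ne_zero.2 Fintype.card_ne_zero
    have hdecomp : f = (∑ c, ((Fintype.card W : ℂ)⁻¹ * fourier BW k c) •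
        fun x => (ZMod.stdAddChar (component BW F c x) : ℂ)) +
        (f 0 - k (F 0)) • fun x => if x = 0 then 1 else 0 := by
      ext x
      have hinv := fourier_inversion hBW k (F x)
      simp only [Pi.add_apply, Finset.sum_apply, Pi.smul_apply, smul_eq_mul, mul_assoc, component]
      rw [← mul_sum, hinv, inv_mul_cancel_left₀ hM]
      by_cases hx : x = 0
      · simp [hx]
      · simp [hx, hk x hx]
    rw [hdecomp]
    simp only [map_add, map_sum, map_smul, Pi.add_apply, Finset.sum_apply, Pi.smul_apply,
      ← walsh_eq_fourier, hall, fourier_single_zero, Pi.one_apply]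

theorem walsh_eq_iff_of_dual (hBV : IsInnerProduct BV) (hBW : IsInnerProduct BW) [Nontrivial V]
    (hG : IsVectorialBent BV BW G)
    (hσ : ∀ c : {c : W // c ≠ 0}, dual BV (component BW F c) = component BW G (σ c)) {b b' : V} :
    (∀ c : {c : W // c ≠ 0},
        walsh BV (component BW F c) b = walsh BV (component BW F c) b') ↔
      G b = G b' ∧ ∀ c : {c : W // c ≠ 0},
        eps BV (component BW F c) b = eps BV (component BW F c) b' := by
  have hq : (halfPow p V : ℂ) ≠ 0 := Complex.ofReal_ne_zero.2 (halfPow_pos p V).ne'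
  constructor
  · intro h
    have huniq : ∀ c : {c : W // c ≠ 0},
        eps BV (component BW F c) b = eps BV (component BW F c) b' ∧
          BW (σ c) (G b) = BW (σ c) (G b') := by
      intro c
      have h1 := walsh_eq_eps hBV hG hσ c b
      have h2 := walsh_eq_eps hBV hG hσ c b'
      refine h1.1.unique h2.1 (mul_left_cancel₀ hq ?_)
      have := h c
      rw [h1.2, h2.2] at this
      linear_combination this
    refine ⟨sub_eq_zero.1 (hBW.2.2 _ fun d => ?_), fun c => (huniq c).1⟩
    by_cases hd : d = 0
    · simp [hd]
    · have := (huniq (σ.symm ⟨d, hd⟩)).2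
      rw [Equiv.apply_symm_apply] at this
      rw [map_sub, this, sub_self]
  · rintro ⟨hGb, he⟩ c
    rw [(walsh_eq_eps hBV hG hσ c b).2, (walsh_eq_eps hBV hG hσ c b').2, hGb, he c]

/-- For images of equal size, the translation scheme exists exactly when the classes of its dual
partition are the fibres of `G` on the nonzero vectors, that is, when the factors are functions of
the value of `G`. -/
theorem isAssociationScheme_iff_eps_eq [Fintype W] [Nontrivial V] (hBV : IsInnerProduct BV)
    (hBW : IsInnerProduct BW) (hFeven : ∀ x, F x = F (-x)) (hG : IsVectorialBent BV BW G)
    (hσ : ∀ c : {c : W // c ≠ 0}, dual BV (component BW F c) = component BW G (σ c))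
    (hcard : (punctImage F).ncard = (punctImage G).ncard) :
    IsAssociationScheme (punctImage F).ncard (translationRel F) ↔
      ∀ b b' : V, b ≠ 0 → b' ≠ 0 → G b = G b' → ∀ c : W, c ≠ 0 →
        eps BV (component BW F c) b = eps BV (component BW F c) b' := by
  classical
  have hone : ∀ b, b ≠ 0 → fourier BV 1 0 ≠ fourier BV 1 b := by
    intro b hb h
    rw [fourier_one hBV, fourier_one hBV, if_pos rfl, if_neg hb] at h
    exact Fintype.card_ne_zero (α := V) (by exact_mod_cast h)
  rw [isAssociationScheme_iff_conv F hFeven, conv_mem_iff_fourier_const hBV (classMap F)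
    (classMap G) (by rw [ncard_range_classMap, ncard_range_classMap, hcard])
    (fun x hx => by rwa [classMap_zero, classMap_eq_none] at hx)]
  · constructor
    · intro h b b' hb hb' hGb c hc
      have hτ : classMap G b = classMap G b' :=
        (classMap_eq_some (i := ⟨G b, b, hb, rfl⟩).2 ⟨hb, rfl⟩).trans
          (classMap_eq_some.2 ⟨hb', hGb.symm⟩).symm
      have hw := (fourier_eq_iff_walsh_eq hBV hBW hb hb').1 (h b b' hτ)
      exact ((walsh_eq_iff_of_dual hBV hBW hG hσ).1 hw).2 ⟨c, hc⟩
    · intro h b b' hτ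
      by_cases hb : b = 0
      · subst hb
        rw [classMap_zero] at hτ
        rw [classMap_eq_none.1 hτ.symm]
        exact fun _ _ => rfl
      · have hb' : b' ≠ 0 := by
          rintro rfl
          rw [classMap_zero] at hτ
          exact hb (classMap_eq_none.1 hτ)
        have hGb := map_eq_of_classMap_eq hτ
        exact (fourier_eq_iff_walsh_eq hBV hBW hb hb').2
          ((walsh_eq_iff_of_dual hBV hBW hG hσ).2
            ⟨hGb, fun c => h b b' hb hb' hGb c c.2⟩)
  · intro b b' h
    have h1 := h 1 fun _ _ _ => rfl
    by_cases hb : b = 0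
    · subst hb
      by_cases hb' : b' = 0
      · rw [hb']
      · exact absurd h1 (hone b' hb')
    · have hb' : b' ≠ 0 := by
        rintro rfl
        exact hone b hb h1.symm
      have hGb := ((walsh_eq_iff_of_dual hBV hBW hG hσ).1
        ((fourier_eq_iff_walsh_eq hBV hBW hb hb').1 h)).1
      exact (classMap_eq_some (i := ⟨G b, b, hb, rfl⟩).2 ⟨hb, rfl⟩).trans
        (classMap_eq_some.2 ⟨hb', hGb.symm⟩).symm

end Scheme

end DualBent

end

theorem theorem8 {p : ℕ} [Fact p.Prime] {n m : ℕ}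
    {V : Type*} [AddCommGroup V] [Module (ZMod p) V] [Fintype V]
    {W : Type*} [AddCommGroup W] [Module (ZMod p) W] [Finite W]
    (hn : Module.finrank (ZMod p) V = n) (hm : Module.finrank (ZMod p) W = m)
    (h2m : 2 ≤ m) (hmn : 2 * m ≤ n)
    (BV : LinearMap.BilinForm (ZMod p) V) (hBV : DualBent.IsInnerProduct BV)
    (BW : LinearMap.BilinForm (ZMod p) W) (hBW : DualBent.IsInnerProduct BW)
    (F : V → W) (hF : DualBent.IsVectorialDualBent BV BW F)
    (hF0 : F 0 = 0) (hFeven : ∀ x, F x = F (-x))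
    (Fstar : V → W) (hFstar : DualBent.IsVectorialDual BV BW F Fstar) :
    -- the exceptional case
    ((Even n ∧ 2 * m = n ∧
        ∀ c : W, c ≠ 0 → DualBent.eps BV (DualBent.component BW F c) 0 = -1) →
      DualBent.punctImage F = {i : W | i ≠ 0} ∧
        (DualBent.punctImage F).ncard = p ^ m - 1) ∧
    -- all other cases
    (¬ (Even n ∧ 2 * m = n ∧
        ∀ c : W, c ≠ 0 → DualBent.eps BV (DualBent.component BW F c) 0 = -1) →
      DualBent.punctImage F = Set.univ ∧
        (DualBent.punctImage F).ncard = p ^ m) ∧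
    -- the criterion for an association scheme
    (DualBent.IsAssociationScheme (DualBent.punctImage F).ncard (DualBent.translationRel F) ↔
      ∀ β β' : V, β ≠ 0 → β' ≠ 0 → Fstar β = Fstar β' →
        ∀ c : W, c ≠ 0 →
          DualBent.eps BV (DualBent.component BW F c) β =
            DualBent.eps BV (DualBent.component BW F c) β') := by
  have := Fintype.ofFinite W
  subst hn hm
  have := DualBent.nontrivial_of_finrank (V := V) h2m hmn
  obtain ⟨hG, σ, hσ⟩ := hFstar
  have hFsurj := hF.1.surjective hBV hBW hmn
  have hGsurj := hG.surjective hBV hBW hmn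
  have hcardW : Nat.card W = p ^ Module.finrank (ZMod p) W := by
    rw [Nat.card_eq_fintype_card, DualBent.card_eq_pow p W]
  have hncard : ∀ g : W, ({i : W | i ≠ g}).ncard = p ^ Module.finrank (ZMod p) W - 1 := by
    intro g
    have h : {i : W | i ≠ g} = {g}ᶜ := rfl
    rw [h, Set.ncard_compl, Set.ncard_singleton, hcardW]
  -- In the exceptional case both images are the nonzero vectors, otherwise both are everything.
  have hexc : (Even (Module.finrank (ZMod p) V) ∧
      2 * Module.finrank (ZMod p) W = Module.finrank (ZMod p) V ∧
      ∀ c : W, c ≠ 0 → DualBent.eps BV (DualBent.component BW F c) 0 = -1) →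
      DualBent.punctImage F = {i : W | i ≠ 0} ∧
        DualBent.punctImage Fstar = {i : W | i ≠ Fstar 0} := by
    rintro ⟨-, hdim, heps⟩
    obtain ⟨hfib, hG0⟩ :=
      DualBent.fiber_zero_of_eps_zero hBV hBW h2m hdim hF0 hFeven hG hσ heps
    constructor
    · have h := DualBent.punctImage_eq_ne hFsurj fun x hx => (hfib x).1 (hx.trans hF0)
      rwa [hF0] at h
    · refine DualBent.punctImage_eq_ne hGsurj fun x hx => ?_
      by_contra hx0
      exact DualBent.dual_ne_zero_of_eps_zero hBV hBW h2m hdim hF0 hFeven hG hσ heps hx0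
        (hx.trans hG0)
  have hgen : ¬ (Even (Module.finrank (ZMod p) V) ∧
      2 * Module.finrank (ZMod p) W = Module.finrank (ZMod p) V ∧
      ∀ c : W, c ≠ 0 → DualBent.eps BV (DualBent.component BW F c) 0 = -1) →
      DualBent.punctImage F = Set.univ ∧ DualBent.punctImage Fstar = Set.univ := by
    intro hne
    have hF1 : ∃ x, x ≠ 0 ∧ F x = 0 := by
      by_contra! h
      have hfib : ∀ x, F x = 0 ↔ x = 0 := fun x =>
        ⟨fun hx => by_contra fun hx0 => h x hx0 hx, fun hx => by rw [hx, hF0]⟩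
      obtain ⟨hdim, heps⟩ :=
        DualBent.eps_zero_eq_neg_one hBV hBW h2m hmn hF.1 hG hσ hfib
      exact hne ⟨hdim ▸ even_two_mul _, hdim, heps⟩
    refine ⟨DualBent.punctImage_eq_univ hFsurj (by rwa [hF0]),
      DualBent.punctImage_eq_univ hGsurj ?_⟩
    by_contra! h
    obtain ⟨x, hx, hFx⟩ := hF1
    exact hx (DualBent.fiber_zero_of_dual_fiber_zero hBV hBW h2m hmn hF0 hFeven hG hσ
      (fun y => ⟨fun hy => by_contra fun hy0 => h y hy0 hy, fun hy => by rw [hy]⟩) x hFx)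
  refine ⟨fun h => ⟨(hexc h).1, ?_⟩, fun h => ⟨(hgen h).1, ?_⟩, ?_⟩
  · rw [(hexc h).1, hncard]
  · rw [(hgen h).1, Set.ncard_univ, hcardW]
  · refine DualBent.isAssociationScheme_iff_eps_eq hBV hBW hFeven hG hσ ?_
    by_cases h : Even (Module.finrank (ZMod p) V) ∧
        2 * Module.finrank (ZMod p) W = Module.finrank (ZMod p) V ∧
        ∀ c : W, c ≠ 0 → DualBent.eps BV (DualBent.component BW F c) 0 = -1
    · rw [(hexc h).1, (hexc h).2, hncard, hncard]
    · rw [(hgen h).1, (hgen h).2]
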